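/- Let $E$ be a Hausdorff sequentially complete locally convex space over $\mathbb{C}$, and let $L(E)$ carry the topology of uniform convergence on bounded sets. Let $\mathcal{D}=C_0^\infty(\mathbb{R})$ (complex-valued), $\mathcal{D}_0=\{\varphi\in\mathcal{D}:\operatorname{supp}\varphi\subseteq[0,\infty)\}$ and $(\varphi*_0\psi)(t)=\int_0^t\varphi(t-s)\psi(s)\,ds$. A distribution semigroup in $E$ is a continuous linear map $\mathcal{G}:\mathcal{D}\to L(E)$ with support in $[0,\infty)$ such that * $\mathcal{G}$ is boundedly equicontinuous: for every continuous seminorm $p$ on $E$ and every bounded $B\subseteq\mathcal{D}$ there are $c>0$ and a continuous seminorm $q$ on $E$ with $p(\mathcal{G}(\varphi)x)\le c\,q(x)$ for all $\varphi\in B$, $x\in E$; * $\mathcal{G}(\varphi*_0\psi)=\mathcal{G}(\varphi)\mathcal{G}(\psi)$ for all $\varphi,\psi\in\mathcal{D}$; * $\bigcap_{\varphi\in\mathcal{D}_0}\ker\mathcal{G}(\varphi)=\{0\}$. Its generator is the operator $\{(x,y)\in E\times E:\mathcal{G}(-\varphi')x=\mathcal{G}(\varphi)y\text{ for all }\varphi\in\mathcal{D}_0\}$;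 an operator generates a distribution semigroup if it is the generator of one. Theorem. Let $A$ be a closed linear operator in $E$ that is stationary dense, i.e. $$n=n(A):=\inf\{k\in\mathbb{N}_0: D(A^m)\subseteq\overline{D(A^{m+1})}\text{ for all }m\ge k\}<\infty .$$ Let $F=\overline{D(A^n)}$ (closure in $E$, with the topology induced by $E$), and let $A_F$ be the part of $A$ in $F$: $D(A_F)=\{x\in D(A)\cap F: Ax\in F\}$, $A_Fx=Ax$. 1. If $A$ generates a distribution semigroup in $E$, then $A_F$ generates a distribution semigroup in $F$. 2. Suppose that the resolvent set of $A$ is non-empty, i.e. for some $\lambda\in\mathbb{C}$ the operator $\lambda-A:D(A)\to E$ is bijective with inverse in $L(E)$. Then $A$ generates a distribution semigroup in $E$ if and only if $A_F$ generates a distribution semigroup in $F$. -/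

import Mathlib

open scoped Distributions LineDeriv

noncomputable section

namespace DistSemigroup

/-- The space `𝒟 = C₀^∞(ℝ)` of complex-valued test functions on the line, with its usual
(inductive limit) topology. -/
abbrev Test : Type := 𝓓((⊤ : TopologicalSpace.Opens ℝ), ℂ)

/-! ### The truncated convolution `φ *₀ ψ (t) = ∫₀ᵗ φ (t - s) ψ (s) ds` on `𝒟` -/

open MeasureTheory in
/-- On test functions, `φ *₀ ψ` is the difference of the two convolutions
`(ψ 1_{(0,∞)}) * φ` and `(φ 1_{(-∞,0)}) * ψ`. -/
theorem truncConv_eq (φ ψ : Test) (t : ℝ) :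
    ∫ s in (0 : ℝ)..t, φ (t - s) * ψ s =
      (MeasureTheory.convolution ((Set.Ioi (0 : ℝ)).indicator ψ) φ
        (ContinuousLinearMap.mul ℝ ℂ) volume t) -
      (MeasureTheory.convolution ((Set.Iio (0 : ℝ)).indicator φ) ψ
        (ContinuousLinearMap.mul ℝ ℂ) volume t) := by
  have hcont : Continuous fun s : ℝ => φ (t - s) * ψ s :=
    (φ.continuous.comp (continuous_const.sub continuous_id)).mul ψ.continuous
  have hint : Integrable (fun s : ℝ => φ (t - s) * ψ s) volume :=
    hcont.integrable_of_hasCompactSupport ψ.hasCompactSupport.mul_left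
  have h1 : MeasureTheory.convolution ((Set.Ioi (0 : ℝ)).indicator ψ) φ
      (ContinuousLinearMap.mul ℝ ℂ) volume t = ∫ s in Set.Ioi (0 : ℝ), φ (t - s) * ψ s := by
    rw [convolution_def, ← integral_indicator measurableSet_Ioi]
    congr 1
    funext s
    by_cases hs : s ∈ Set.Ioi (0 : ℝ)
    · simp [Set.indicator_of_mem hs, mul_comm]
    · simp [Set.indicator_of_notMem hs]
  have h2 : MeasureTheory.convolution ((Set.Iio (0 : ℝ)).indicator φ) ψ
      (ContinuousLinearMap.mul ℝ ℂ) volume t = ∫ s in Set.Ioi t, φ (t - s) * ψ s := by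
    rw [convolution_eq_swap, ← integral_indicator measurableSet_Ioi]
    congr 1
    funext s
    by_cases hs : s ∈ Set.Ioi t
    · have : t - s ∈ Set.Iio (0 : ℝ) := by simpa using hs
      simp [Set.indicator_of_mem hs, Set.indicator_of_mem this]
    · have : t - s ∉ Set.Iio (0 : ℝ) := by simpa using hs
      simp [Set.indicator_of_notMem hs, Set.indicator_of_notMem this]
  rw [h1, h2, intervalIntegral.integral_Ioi_sub_Ioi' hint.integrableOn hint.integrableOn]

theorem truncConv_contDiff (φ ψ : Test) :
    ContDiff ℝ ((⊤ : ℕ∞) : WithTop ℕ∞) fun t : ℝ => ∫ s in (0 : ℝ)..t, φ (t - s) * ψ s := by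
  simp only [truncConv_eq]
  have hφ : MeasureTheory.LocallyIntegrable ((Set.Iio (0 : ℝ)).indicator φ) :=
    ((φ.continuous.integrable_of_hasCompactSupport φ.hasCompactSupport).indicator
      measurableSet_Iio).locallyIntegrable
  have hψ : MeasureTheory.LocallyIntegrable ((Set.Ioi (0 : ℝ)).indicator ψ) :=
    ((ψ.continuous.integrable_of_hasCompactSupport ψ.hasCompactSupport).indicator
      measurableSet_Ioi).locallyIntegrable
  exact (φ.hasCompactSupport.contDiff_convolution_right _ hψ φ.contDiff).sub
    (ψ.hasCompactSupport.contDiff_convolution_right _ hφ ψ.contDiff)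

theorem truncConv_hasCompactSupport (φ ψ : Test) :
    HasCompactSupport fun t : ℝ => ∫ s in (0 : ℝ)..t, φ (t - s) * ψ s := by
  simp only [truncConv_eq]
  have hφ : HasCompactSupport ((Set.Iio (0 : ℝ)).indicator φ) :=
    φ.hasCompactSupport.mono (by rw [Set.support_indicator]; exact Set.inter_subset_right)
  have hψ : HasCompactSupport ((Set.Ioi (0 : ℝ)).indicator ψ) :=
    ψ.hasCompactSupport.mono (by rw [Set.support_indicator]; exact Set.inter_subset_right)
  have h1 := HasCompactSupport.convolution (ContinuousLinearMap.mul ℝ ℂ)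
    (μ := MeasureTheory.volume) hψ φ.hasCompactSupport
  have h2 := HasCompactSupport.convolution (ContinuousLinearMap.mul ℝ ℂ)
    (μ := MeasureTheory.volume) hφ ψ.hasCompactSupport
  exact h1.sub h2

/-- The truncated convolution `φ *₀ ψ (t) = ∫₀ᵗ φ (t - s) ψ (s) ds` as a test function. -/
def truncConv (φ ψ : Test) : Test where
  toFun t := ∫ s in (0 : ℝ)..t, φ (t - s) * ψ s
  contDiff' := truncConv_contDiff φ ψ
  hasCompactSupport' := truncConv_hasCompactSupport φ ψ
  tsupport_subset' := fun _ _ => trivial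

/-- `𝒟₀`: the test functions with support in `[0, ∞)`. -/
def testNonneg : Set Test := {φ | tsupport φ ⊆ Set.Ici (0 : ℝ)}

/-! ### Distribution semigroups and their generators -/

section Semigroup

variable {E : Type*} [AddCommGroup E] [Module ℂ E] [TopologicalSpace E]
  [IsTopologicalAddGroup E] [ContinuousSMul ℂ E]

/-- An `L(E)`-valued distribution is boundedly equicontinuous if for every continuous seminorm `p`
and every bounded `B ⊆ 𝒟` there are `c > 0` and a continuous seminorm `q` with
`p (G φ x) ≤ c q x` for `φ ∈ B`, `x ∈ E`. -/
def BoundedlyEquicontinuous (G : Test →L[ℂ] (E →L[ℂ] E)) : Prop :=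
  ∀ p : Seminorm ℂ E, Continuous p → ∀ B : Set Test, Bornology.IsVonNBounded ℂ B →
    ∃ c : ℝ, 0 < c ∧ ∃ q : Seminorm ℂ E, Continuous q ∧
      ∀ φ ∈ B, ∀ x : E, p (G φ x) ≤ c * q x

/-- Distribution semigroups on `E`. Here `E →L[ℂ] E` carries the topology of uniform convergence
on bounded sets, so that `Test →L[ℂ] (E →L[ℂ] E)` is the space `𝒟'(L(E))`. -/
structure IsDistributionSemigroup (G : Test →L[ℂ] (E →L[ℂ] E)) : Prop where
  /-- `G ∈ 𝒟₀'(L(E))`: the support of `G` is contained in `[0, ∞)`. -/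
  support_subset : Distribution.dsupport G ⊆ Set.Ici (0 : ℝ)
  boundedlyEquicontinuous : BoundedlyEquicontinuous G
  /-- `G(φ *₀ ψ) = G(φ) G(ψ)`. -/
  map_truncConv : ∀ φ ψ : Test, G (truncConv φ ψ) = (G φ).comp (G ψ)
  /-- The kernels of the `G(φ)`, `φ ∈ 𝒟₀`, have trivial intersection. -/
  nondegenerate : ∀ x : E, (∀ φ ∈ testNonneg, G φ x = 0) → x = 0

/-- `A` is the (infinitesimal) generator `G(-δ')` of `G`: its graph consists of the `(x, y)` with
`G((-δ') * φ) x = G(φ) y` for all `φ ∈ 𝒟₀`, where `(-δ') * φ = -φ'`. -/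
def IsGenerator (A : E →ₗ.[ℂ] E) (G : Test →L[ℂ] (E →L[ℂ] E)) : Prop :=
  ∀ x y : E, (x, y) ∈ A.graph ↔ ∀ φ ∈ testNonneg, G (-(∂_{(1 : ℝ)} φ)) x = G φ y

/-- `A` generates a distribution semigroup in `E`. -/
def GeneratesDistributionSemigroup (A : E →ₗ.[ℂ] E) : Prop :=
  ∃ G : Test →L[ℂ] (E →L[ℂ] E), IsDistributionSemigroup G ∧ IsGenerator A G

end Semigroup

/-! ### Operators -/

section Operators

variable {E : Type*} [AddCommGroup E] [Module ℂ E]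

/-- The domains of the powers of `A`: `D(A⁰) = E` and
`D(A^(m+1)) = {x ∈ D(A) | A x ∈ D(A^m)}`. -/
def powDomain (A : E →ₗ.[ℂ] E) : ℕ → Submodule ℂ E
  | 0 => ⊤
  | m + 1 => ((powDomain A m).comap A.toFun).map A.domain.subtype

/-- The part `A_F` of `A` in the subspace `F`: `D(A_F) = {x ∈ D(A) ∩ F | A x ∈ F}`, `A_F x = A x`. -/
def part (A : E →ₗ.[ℂ] E) (F : Submodule ℂ E) : F →ₗ.[ℂ] F where
  domain :=
    { carrier := {x | ∃ h : (x : E) ∈ A.domain, A ⟨x, h⟩ ∈ F}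
      zero_mem' := ⟨A.domain.zero_mem, by
        have h0 : A (0 : A.domain) ∈ F := by rw [A.map_zero]; exact F.zero_mem
        exact h0⟩
      add_mem' := by
        rintro x y ⟨hx, hx'⟩ ⟨hy, hy'⟩
        have hxy : A (⟨x, hx⟩ + ⟨y, hy⟩ : A.domain) ∈ F := by
          rw [A.map_add]; exact F.add_mem hx' hy'
        exact ⟨A.domain.add_mem hx hy, hxy⟩
      smul_mem' := by
        rintro c x ⟨hx, hx'⟩
        have hcx : A (c • (⟨x, hx⟩ : A.domain)) ∈ F := by
          rw [A.map_smul]; exact F.smul_mem c hx'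
        exact ⟨A.domain.smul_mem c hx, hcx⟩ }
  toFun :=
    { toFun := fun x => ⟨A ⟨x, x.2.fst⟩, x.2.snd⟩
      map_add' := fun x y => Subtype.ext (A.map_add ⟨x, x.2.fst⟩ ⟨y, y.2.fst⟩)
      map_smul' := fun c x => Subtype.ext (A.map_smul c ⟨x, x.2.fst⟩) }

variable [TopologicalSpace E]

/-- The resolvent set of `A`: all `z` such that `z - A` is a bijection from `D(A)` onto `E` with
inverse in `L(E)`. -/
def resolvents (A : E →ₗ.[ℂ] E) : Set ℂ :=
  {z | ∃ R : E →L[ℂ] E, (∀ x : A.domain, R (z • (x : E) - A x) = x) ∧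
    ∀ y : E, ∃ h : R y ∈ A.domain, z • R y - A ⟨R y, h⟩ = y}

/-- The `k ∈ ℕ₀` with `D(A^m) ⊆ closure (D(A^(m+1)))` for all `m ≥ k`. -/
def stationaryIndices (A : E →ₗ.[ℂ] E) : Set ℕ :=
  {k | ∀ m ≥ k, (powDomain A m : Set E) ⊆ closure (powDomain A (m + 1) : Set E)}

/-- `n(A)`; meaningful when `stationaryIndices A` is nonempty, i.e. `n(A) < ∞`. -/
def stationaryIndex (A : E →ₗ.[ℂ] E) : ℕ := sInf (stationaryIndices A)

/-- `A` is stationary dense: `A` is closed and `n(A) < ∞`. -/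
def IsStationaryDense (A : E →ₗ.[ℂ] E) : Prop :=
  A.IsClosed ∧ (stationaryIndices A).Nonempty

variable [IsTopologicalAddGroup E] [ContinuousSMul ℂ E]

/-- `F`, the closure of `D(A^n)` in `E`, where `n = n(A)`. -/
def stationaryClosure (A : E →ₗ.[ℂ] E) : Submodule ℂ E :=
  (powDomain A (stationaryIndex A)).topologicalClosure

end Operators

end DistSemigroup

end

namespace DistSemigroup

/-! ### Test functions -/

/-! Passing to `F`: each `G φ` commutes with the generator `A`, so it preserves every D(A^m) and, by
continuity, its closure; the restricted distribution generates the part of `A` there. Passing back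
to `E`: let R be the resolvent at z. Since Rⁿ maps E into D(Aⁿ) ⊆ F, put G̃(φ) = (z - A)ⁿ G(φ) Rⁿ.
From A G(φ) = -G(φ') - φ(0) (`apply_mem_graph`), with Dφ = zφ + φ', one gets (z - A) G(φ) = G(Dφ) +
φ(0). Iterating gives G̃(φ) = G(Dⁿφ) Rⁿ + ∑_{j<n} (Dʲφ)(0) R^{j+1}, which involves bounded operators
only (`extend`). The intertwining Rⁿ G̃(φ) = G(φ) Rⁿ (`resolvent_pow_extend`) and injectivity of Rⁿ
then carry the semigroup law, nondegeneracy and the generator from F to E. -/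

theorem lineDeriv_apply (φ : Test) (t : ℝ) : (∂_{(1 : ℝ)} φ : Test) t = deriv φ t := by
  change (TestFunction.lineDerivCLM ℝ (1 : ℝ) φ : Test) t = deriv φ t
  rw [TestFunction.lineDerivCLM_apply_of_le (by simp)]
  simp [lineDeriv, deriv_comp_const_add]

theorem hasDerivAt_test (φ : Test) (t : ℝ) : HasDerivAt φ ((∂_{(1 : ℝ)} φ : Test) t) t := by
  rw [lineDeriv_apply]
  exact (φ.contDiff.differentiable (by simp) t).hasDerivAt

theorem tsupport_lineDeriv_subset (φ : Test) : tsupport (∂_{(1 : ℝ)} φ : Test) ⊆ tsupport φ := by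
  have h : ⇑(∂_{(1 : ℝ)} φ : Test) = deriv φ := funext (lineDeriv_apply φ)
  rw [h]
  exact tsupport_deriv_subset

theorem apply_zero_of_mem_testNonneg {φ : Test} (hφ : φ ∈ testNonneg) : φ 0 = 0 := by
  have hneg : Set.EqOn φ 0 (Set.Iio 0) := fun t ht =>
    image_eq_zero_of_notMem_tsupport fun h => not_le_of_gt (Set.mem_Iio.mp ht) (Set.mem_Ici.mp (hφ h))
  have hcl := hneg.closure φ.continuous continuous_const
  rw [closure_Iio] at hcl
  exact hcl (Set.mem_Iic.mpr le_rfl)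

theorem truncConv_apply (φ ψ : Test) (t : ℝ) :
    truncConv φ ψ t = ∫ s in (0 : ℝ)..t, φ (t - s) * ψ s := rfl

/-- Substituting s ↦ t - s. This is what makes the operators `G φ` commute with each other. -/
theorem truncConv_comm (φ ψ : Test) : truncConv φ ψ = truncConv ψ φ := by
  ext t
  rw [truncConv_apply, truncConv_apply]
  have h := intervalIntegral.integral_comp_sub_left (a := 0) (b := t)
    (fun s => ψ (t - s) * φ s) t
  simp only [sub_sub_cancel, sub_self, sub_zero] at h
  rw [← h]
  exact intervalIntegral.integral_congr fun s _ => mul_comm _ _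

/-- Integration by parts for the truncated convolution. -/
theorem truncConv_neg_lineDeriv {ψ : Test} (hψ : ψ ∈ testNonneg) (φ : Test) :
    truncConv (-(∂_{(1 : ℝ)} ψ)) φ = -truncConv ψ (∂_{(1 : ℝ)} φ) - φ 0 • ψ := by
  ext t
  have hc : Continuous fun s : ℝ => t - s := continuous_const.sub continuous_id
  have h := intervalIntegral.integral_mul_deriv_eq_deriv_mul (a := 0) (b := t)
    (u := fun s => ψ (t - s)) (u' := fun s => (-(∂_{(1 : ℝ)} ψ) : Test) (t - s))
    (v := φ) (v' := (∂_{(1 : ℝ)} φ : Test))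
    (fun s _ => by
      have h := (hasDerivAt_test ψ (t - s)).scomp s ((hasDerivAt_id s).const_sub t)
      rw [neg_one_smul] at h
      exact h)
    (fun s _ => hasDerivAt_test φ s)
    (((-(∂_{(1 : ℝ)} ψ) : Test).continuous.comp hc).intervalIntegrable _ _)
    ((∂_{(1 : ℝ)} φ : Test).continuous.intervalIntegrable _ _)
  change (∫ s in (0 : ℝ)..t, (-(∂_{(1 : ℝ)} ψ) : Test) (t - s) * φ s) =
    -(∫ s in (0 : ℝ)..t, ψ (t - s) * (∂_{(1 : ℝ)} φ : Test) s) - φ 0 * ψ t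
  rw [h]
  -- The boundary term at s = t contains ψ(0) = 0; the one at s = 0 survives as φ(0) ψ(t).
  simp only [sub_self, sub_zero, apply_zero_of_mem_testNonneg hψ]
  ring

/-- The operator `φ ↦ z φ + φ'` on test functions. -/
noncomputable def shiftDeriv (z : ℂ) : Test →L[ℂ] Test :=
  TestFunction.postcompCLM (z • ContinuousLinearMap.id ℂ ℂ) +
    TestFunction.lineDerivCLM ℂ (1 : ℝ)

theorem shiftDeriv_apply (z : ℂ) (φ : Test) :
    shiftDeriv z φ = z • φ + ∂_{(1 : ℝ)} φ := rfl

theorem tsupport_shiftDeriv_pow_subset (z : ℂ) (n : ℕ) (φ : Test) :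
    tsupport ((shiftDeriv z ^ n) φ) ⊆ tsupport φ := by
  induction n with
  | zero => exact subset_rfl
  | succ n ih =>
    rw [pow_succ', mul_apply_eq_comp, shiftDeriv_apply]
    refine (tsupport_add _ _).trans (Set.union_subset ?_ ?_)
    · exact (tsupport_smul_subset_right (fun _ => z) _).trans ih
    · exact (tsupport_lineDeriv_subset _).trans ih

/-- Evaluation of test functions at the origin. -/
noncomputable def evalZero : Test →L[ℂ] ℂ where
  toFun φ := φ 0
  map_add' _ _ := rfl
  map_smul' _ _ := rfl
  cont := continuous_eval_const (0 : ℝ)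

theorem evalZero_apply (φ : Test) : evalZero φ = φ 0 := rfl

/-! ### Bounded equicontinuity -/

section Equicontinuity

variable {E F : Type*} [AddCommGroup E] [Module ℂ E] [TopologicalSpace E]
  [IsTopologicalAddGroup E] [ContinuousSMul ℂ E]
  [AddCommGroup F] [Module ℂ F] [TopologicalSpace F]
  [IsTopologicalAddGroup F] [ContinuousSMul ℂ F]

theorem BoundedlyEquicontinuous.add {G H : Test →L[ℂ] (E →L[ℂ] E)}
    (hG : BoundedlyEquicontinuous G) (hH : BoundedlyEquicontinuous H) :
    BoundedlyEquicontinuous (G + H) := by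
  intro p hp B hB
  obtain ⟨c, hc, q, hq, h⟩ := hG p hp B hB
  obtain ⟨d, hd, r, hr, k⟩ := hH p hp B hB
  refine ⟨max c d, lt_max_of_lt_left hc, q + r, hq.add hr, fun φ hφ x => ?_⟩
  calc p (G φ x + H φ x) ≤ p (G φ x) + p (H φ x) := map_add_le_add p _ _
    _ ≤ c * q x + d * r x := add_le_add (h φ hφ x) (k φ hφ x)
    _ ≤ max c d * q x + max c d * r x :=
        add_le_add (mul_le_mul_of_nonneg_right (le_max_left _ _) (apply_nonneg q x))
          (mul_le_mul_of_nonneg_right (le_max_right _ _) (apply_nonneg r x))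
    _ = max c d * (q + r) x := by rw [add_apply]; ring

theorem boundedlyEquicontinuous_smulRight (f : Test →L[ℂ] ℂ) (T : E →L[ℂ] E) :
    BoundedlyEquicontinuous (f.smulRight T) := by
  intro p hp B hB
  obtain ⟨C, hC⟩ := ((NormedSpace.isVonNBounded_iff ℂ).mp (hB.image f)).exists_norm_le
  -- The maximum with 1 only secures a positive constant.
  refine ⟨max C 1, lt_max_of_lt_right one_pos, p.comp T.toLinearMap, hp.comp T.continuous,
    fun φ hφ x => ?_⟩
  change p (f φ • T x) ≤ _ * p (T x)
  rw [map_smul_eq_mul]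
  exact mul_le_mul_of_nonneg_right
    ((hC _ (Set.mem_image_of_mem f hφ)).trans (le_max_left _ _)) (apply_nonneg p _)

theorem boundedlyEquicontinuous_zero :
    BoundedlyEquicontinuous (0 : Test →L[ℂ] (E →L[ℂ] E)) := fun p hp _ _ =>
  ⟨1, one_pos, p, hp, fun _ _ x => by simp⟩

theorem boundedlyEquicontinuous_sum {ι : Type*} (s : Finset ι)
    {G : ι → Test →L[ℂ] (E →L[ℂ] E)} (hG : ∀ i, BoundedlyEquicontinuous (G i)) :
    BoundedlyEquicontinuous (∑ i ∈ s, G i) :=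
  Finset.sum_induction G BoundedlyEquicontinuous (fun _ _ => .add)
    boundedlyEquicontinuous_zero fun i _ => hG i

/-- Transport of an operator-valued distribution along `S : E → F` and `T : F → E`,
precomposed with an operator on test functions. -/
noncomputable def conjugate (G : Test →L[ℂ] (F →L[ℂ] F)) (D : Test →L[ℂ] Test) (S : E →L[ℂ] F)
    (T : F →L[ℂ] E) : Test →L[ℂ] (E →L[ℂ] E) :=
  ((T.postcomp E).comp (S.precomp F)).comp (G.comp D)

theorem conjugate_apply (G : Test →L[ℂ] (F →L[ℂ] F)) (D : Test →L[ℂ] Test) (S : E →L[ℂ] F)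
    (T : F →L[ℂ] E) (φ : Test) (x : E) : conjugate G D S T φ x = T (G (D φ) (S x)) := rfl

theorem BoundedlyEquicontinuous.conjugate {G : Test →L[ℂ] (F →L[ℂ] F)}
    (hG : BoundedlyEquicontinuous G) (D : Test →L[ℂ] Test) (S : E →L[ℂ] F) (T : F →L[ℂ] E) :
    BoundedlyEquicontinuous (conjugate G D S T) := by
  intro p hp B hB
  obtain ⟨c, hc, q, hq, h⟩ :=
    hG (p.comp T.toLinearMap) (hp.comp T.continuous) (D '' B) (hB.image D)
  exact ⟨c, hc, q.comp S.toLinearMap, hq.comp S.continuous,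
    fun φ hφ x => h (D φ) (Set.mem_image_of_mem D hφ) (S x)⟩

end Equicontinuity

/-! ### Powers, parts and resolvents of operators -/

section Operators

variable {E : Type*} [AddCommGroup E] [Module ℂ E]

theorem mem_powDomain_succ {A : E →ₗ.[ℂ] E} {m : ℕ} {x : E} :
    x ∈ powDomain A (m + 1) ↔ ∃ y ∈ powDomain A m, (x, y) ∈ A.graph := by
  simp only [powDomain, Submodule.mem_map, Submodule.mem_comap, LinearPMap.mem_graph_iff]
  constructor
  · rintro ⟨u, hu, rfl⟩
    exact ⟨A u, hu, u, rfl, rfl⟩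
  · rintro ⟨y, hy, u, rfl, rfl⟩
    exact ⟨u, hy, rfl⟩

theorem powDomain_succ_le (A : E →ₗ.[ℂ] E) (m : ℕ) : powDomain A (m + 1) ≤ powDomain A m := by
  induction m with
  | zero => exact le_top
  | succ m ih =>
    intro x hx
    obtain ⟨y, hy, hxy⟩ := mem_powDomain_succ.mp hx
    exact mem_powDomain_succ.mpr ⟨y, ih hy, hxy⟩

theorem mem_graph_part {A : E →ₗ.[ℂ] E} {F : Submodule ℂ E} {x y : F} :
    (x, y) ∈ (part A F).graph ↔ ((x : E), (y : E)) ∈ A.graph := by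
  simp only [LinearPMap.mem_graph_iff]
  constructor
  · rintro ⟨u, rfl, rfl⟩
    exact ⟨⟨u, u.2.fst⟩, rfl, rfl⟩
  · rintro ⟨u, hu, hy⟩
    have hx : (x : E) ∈ A.domain := hu ▸ u.2
    have hux : u = ⟨x, hx⟩ := Subtype.ext hu
    subst hux
    exact ⟨⟨x, hx, by rw [hy]; exact y.2⟩, rfl, Subtype.ext hy⟩

/-- An operator commuting with `A` leaves the domains of the powers of `A` invariant. -/
theorem map_mem_powDomain {A : E →ₗ.[ℂ] E} {T : E → E}
    (hT : ∀ x y, (x, y) ∈ A.graph → (T x, T y) ∈ A.graph) (m : ℕ) {x : E}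
    (hx : x ∈ powDomain A m) : T x ∈ powDomain A m := by
  induction m generalizing x with
  | zero => trivial
  | succ m ih =>
    obtain ⟨y, hy, hxy⟩ := mem_powDomain_succ.mp hx
    exact mem_powDomain_succ.mpr ⟨T y, ih hy, hT x y hxy⟩

variable [TopologicalSpace E]

/-- `R` is the resolvent of `A` at `z`. -/
def IsResolventAt (A : E →ₗ.[ℂ] E) (z : ℂ) (R : E →L[ℂ] E) : Prop :=
  ∀ x y : E, (x, y) ∈ A.graph ↔ R (z • x - y) = x

theorem exists_isResolventAt {A : E →ₗ.[ℂ] E} {z : ℂ} (hz : z ∈ resolvents A) :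
    ∃ R : E →L[ℂ] E, Function.Injective R ∧ IsResolventAt A z R := by
  obtain ⟨R, hl, hr⟩ := hz
  refine ⟨R, fun u v huv => ?_, fun x y => ?_⟩
  · obtain ⟨hu, hu'⟩ := hr u
    obtain ⟨hv, hv'⟩ := hr v
    rw [← hu', ← hv']
    simp only [huv]
  · rw [LinearPMap.mem_graph_iff]
    constructor
    · rintro ⟨u, rfl, rfl⟩
      exact hl u
    · intro h
      obtain ⟨k, hk⟩ := hr (z • x - y)
      refine ⟨⟨_, k⟩, h, ?_⟩
      simp only [h] at hk ⊢
      exact sub_right_injective hk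

namespace IsResolventAt

variable {A : E →ₗ.[ℂ] E} {z : ℂ} {R : E →L[ℂ] E}

/-- Because A R x = z R x - x, the image A R x is again in the domain required by the induction. -/
theorem mem_powDomain_succ_of_mem [IsTopologicalAddGroup E] (hR : IsResolventAt A z R)
    (m : ℕ) {x : E} (hx : x ∈ powDomain A m) : R x ∈ powDomain A (m + 1) := by
  have key (x : E) : (R x, z • R x - x) ∈ A.graph := by rw [hR, sub_sub_cancel]
  induction m generalizing x with
  | zero => exact mem_powDomain_succ.mpr ⟨_, trivial, key x⟩
  | succ m ih =>
    exact mem_powDomain_succ.mpr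
      ⟨_, sub_mem (Submodule.smul_mem _ z (ih (powDomain_succ_le A m hx))) hx, key x⟩

theorem pow_mem_powDomain [IsTopologicalAddGroup E] (hR : IsResolventAt A z R) (m : ℕ) (x : E) :
    (R ^ m) x ∈ powDomain A m := by
  induction m with
  | zero => trivial
  | succ m ih =>
    rw [pow_succ', mul_apply_eq_comp]
    exact hR.mem_powDomain_succ_of_mem m ih

/-- The graph of `A` can be read off after applying a power of the resolvent. -/
theorem mem_graph_pow_iff (hR : IsResolventAt A z R) (hinj : Function.Injective R) (m : ℕ)
    (x y : E) : ((R ^ m) x, (R ^ m) y) ∈ A.graph ↔ (x, y) ∈ A.graph := by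
  have hm : Function.Injective (R ^ m) := by
    rw [FunLike.coe_pow_eq_iterate]
    exact hinj.iterate m
  -- In resolvent form the left side reads Rᵐ(R(zx - y)) = Rᵐx, and Rᵐ cancels.
  rw [hR, hR, ← map_smul, ← map_sub, ← mul_apply_eq_comp, ← pow_succ', pow_succ,
    mul_apply_eq_comp, hm.eq_iff]

end IsResolventAt

end Operators

/-! ### Distribution semigroups and their generators -/

section Semigroup

variable {E : Type*} [AddCommGroup E] [Module ℂ E] [TopologicalSpace E]
  [IsTopologicalAddGroup E] [ContinuousSMul ℂ E] {A : E →ₗ.[ℂ] E}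
  {G : Test →L[ℂ] (E →L[ℂ] E)}

namespace IsDistributionSemigroup

theorem map_truncConv_apply (hG : IsDistributionSemigroup G) (φ ψ : Test) (x : E) :
    G (truncConv φ ψ) x = G φ (G ψ x) := by
  rw [hG.map_truncConv]
  rfl

theorem apply_comm (hG : IsDistributionSemigroup G) (φ ψ : Test) (x : E) :
    G φ (G ψ x) = G ψ (G φ x) := by
  rw [← hG.map_truncConv_apply, truncConv_comm, hG.map_truncConv_apply]

/-- The operators `G φ` commute with the generator. -/
theorem map_mem_graph (hG : IsDistributionSemigroup G) (hA : IsGenerator A G) (ψ : Test) {x y : E}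
    (hxy : (x, y) ∈ A.graph) : (G ψ x, G ψ y) ∈ A.graph := by
  rw [hA] at hxy ⊢
  intro φ hφ
  rw [hG.apply_comm, hxy φ hφ, hG.apply_comm]

/-- `A G(φ) x = -G(φ') x - φ(0) x`. -/
theorem apply_mem_graph (hG : IsDistributionSemigroup G) (hA : IsGenerator A G) (φ : Test)
    (x : E) : (G φ x, -G (∂_{(1 : ℝ)} φ) x - φ 0 • x) ∈ A.graph := by
  rw [hA]
  intro ψ hψ
  -- The product G(-ψ') G(φ) is G of a truncated convolution, where the derivative can be moved onto
  -- φ.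
  rw [← hG.map_truncConv_apply, truncConv_neg_lineDeriv hψ]
  simp only [map_sub, map_neg, map_smul, sub_apply,
    neg_apply, smul_apply, hG.map_truncConv_apply]

end IsDistributionSemigroup

end Semigroup

/-! ### Local convexity -/

/-- Nonnegative complex scalars are real, so real and complex convexity agree. The resulting complex
seminorms are needed to dominate seminorms on a subspace by seminorms on `E`. -/
theorem polynormableSpace_complex (E : Type*) [AddCommGroup E] [Module ℂ E] [TopologicalSpace E]
    [IsTopologicalAddGroup E] [ContinuousSMul ℂ E] [LocallyConvexSpace ℝ E] :
    PolynormableSpace ℂ E := by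
  open scoped ComplexOrder in
  have : ContinuousSMul ℝ E := IsScalarTower.continuousSMul ℂ
  have : LocallyConvexSpace ℂ E := ⟨fun x => by
    refine (LocallyConvexSpace.convex_basis (𝕜 := ℝ) x).to_hasBasis
      (fun s hs => ⟨s, ⟨hs.1, ?_⟩, subset_rfl⟩) (fun s hs => ⟨s, ⟨hs.1, ?_⟩, subset_rfl⟩)
    · exact convex_of_nonneg_surjective_algebraMap _
        (fun _ hc => RCLike.nonneg_iff_exists_ofReal.mp (Set.mem_Ici.mp hc)) hs.2
    · exact hs.2.lift ℝ⟩
  infer_instance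

/-! ### Restriction to an invariant subspace -/

section Restriction

variable {E : Type*} [AddCommGroup E] [Module ℂ E] [TopologicalSpace E]
  [IsTopologicalAddGroup E] [ContinuousSMul ℂ E] {A : E →ₗ.[ℂ] E}
  {G : Test →L[ℂ] (E →L[ℂ] E)} {F : Submodule ℂ E}

/-- The restriction of an operator-valued distribution to an invariant subspace. -/
noncomputable def restrict (G : Test →L[ℂ] (E →L[ℂ] E)) (F : Submodule ℂ E)
    (h : ∀ φ, ∀ x ∈ F, G φ x ∈ F) : Test →L[ℂ] (F →L[ℂ] F) where
  toFun φ := ((G φ).comp F.subtypeL).codRestrict F fun x => h φ x x.2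
  map_add' φ ψ := by
    ext x
    exact congrArg (fun T : E →L[ℂ] E => T x) (map_add G φ ψ)
  map_smul' c φ := by
    ext x
    exact congrArg (fun T : E →L[ℂ] E => T x) (map_smul G c φ)
  cont := by
    -- L(F) carries the topology induced from L(F, E), where the map is `G` followed by restriction
    -- of operators to F.
    rw [(ContinuousLinearMap.isInducing_postcomp (E := F) (σ := RingHom.id ℂ) F.subtypeL
      Topology.IsInducing.subtypeVal).continuous_iff]
    exact ((F.subtypeL.precomp E).comp G).continuous

theorem coe_restrict_apply (h : ∀ φ, ∀ x ∈ F, G φ x ∈ F) (φ : Test) (x : F) :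
    (restrict G F h φ x : E) = G φ x := rfl

theorem BoundedlyEquicontinuous.restrict [PolynormableSpace ℂ E]
    (hG : BoundedlyEquicontinuous G) (h : ∀ φ, ∀ x ∈ F, G φ x ∈ F) :
    BoundedlyEquicontinuous (restrict G F h) := by
  intro p hp B hB
  obtain ⟨p', hp', hle⟩ := Seminorm.exists_le_comp_of_isInducing hp
    (f := F.subtype) Topology.IsInducing.subtypeVal
  obtain ⟨c, hc, q, hq, hb⟩ := hG p' hp' B hB
  exact ⟨c, hc, q.comp F.subtype, hq.comp continuous_subtype_val,
    fun φ hφ x => (hle _).trans (hb φ hφ x)⟩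

theorem IsDistributionSemigroup.restrict [PolynormableSpace ℂ E]
    (hG : IsDistributionSemigroup G) (h : ∀ φ, ∀ x ∈ F, G φ x ∈ F) :
    IsDistributionSemigroup (restrict G F h) where
  support_subset := by
    intro t ht
    rw [Distribution.mem_dsupport_iff_not_isVanishingOn] at ht
    refine hG.support_subset ((Distribution.mem_dsupport_iff_not_isVanishingOn t).mpr
      fun s hts hso hs => ht s hts hso fun φ hφ => ?_)
    ext x
    rw [coe_restrict_apply, hs φ hφ]
    rfl
  boundedlyEquicontinuous := hG.boundedlyEquicontinuous.restrict h
  map_truncConv φ ψ := by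
    ext x
    exact hG.map_truncConv_apply φ ψ x
  nondegenerate x hx := Subtype.ext <| hG.nondegenerate x fun φ hφ =>
    congrArg Subtype.val (hx φ hφ)

theorem IsGenerator.restrict (hA : IsGenerator A G) (h : ∀ φ, ∀ x ∈ F, G φ x ∈ F) :
    IsGenerator (part A F) (restrict G F h) := fun x y => by
  rw [mem_graph_part, hA]
  exact forall₂_congr fun φ _ => (Subtype.ext_iff (a1 := DistSemigroup.restrict G F h _ x)
    (a2 := DistSemigroup.restrict G F h φ y)).symm

theorem GeneratesDistributionSemigroup.part [PolynormableSpace ℂ E]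
    (hA : GeneratesDistributionSemigroup A) (m : ℕ) :
    GeneratesDistributionSemigroup (part A (powDomain A m).topologicalClosure) := by
  obtain ⟨G, hG, hgen⟩ := hA
  have h (φ : Test) : ∀ x ∈ (powDomain A m).topologicalClosure,
      G φ x ∈ (powDomain A m).topologicalClosure := fun x hx =>
    map_mem_closure (G φ).continuous hx fun y hy =>
      map_mem_powDomain (T := G φ) (fun _ _ => hG.map_mem_graph hgen φ) m hy
  exact ⟨_, hG.restrict h, hgen.restrict h⟩

end Restriction

/-! ### Extension from a subspace containing the range of a power of the resolvent -/

section Extension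

variable {E : Type*} [AddCommGroup E] [Module ℂ E] [TopologicalSpace E]
  [IsTopologicalAddGroup E] [ContinuousSMul ℂ E] {A : E →ₗ.[ℂ] E} {F : Submodule ℂ E}
  {G : Test →L[ℂ] (F →L[ℂ] F)} {z : ℂ} {R : E →L[ℂ] E} {n : ℕ}

/-- The distribution `φ ↦ (z - A)ⁿ G(φ) Rⁿ`, expressed through bounded operators. -/
noncomputable def extend (G : Test →L[ℂ] (F →L[ℂ] F)) (z : ℂ) (R : E →L[ℂ] E) (n : ℕ)
    (hF : ∀ x, (R ^ n) x ∈ F) : Test →L[ℂ] (E →L[ℂ] E) :=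
  conjugate G (shiftDeriv z ^ n) ((R ^ n).codRestrict F hF) F.subtypeL +
    ∑ j ∈ Finset.range n, (evalZero.comp (shiftDeriv z ^ j)).smulRight (R ^ (j + 1))

theorem extend_apply (hF : ∀ x, (R ^ n) x ∈ F) (φ : Test) (x : E) :
    extend G z R n hF φ x = (G ((shiftDeriv z ^ n) φ) ⟨(R ^ n) x, hF x⟩ : E) +
      ∑ j ∈ Finset.range n, ((shiftDeriv z ^ j) φ) 0 • (R ^ (j + 1)) x := by
  simp only [extend, add_apply, sum_apply,
    ContinuousLinearMap.smulRight_apply, smul_apply,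
    ContinuousLinearMap.comp_apply, evalZero_apply, conjugate_apply]
  rfl

/-- Applying R to (z - A) G(φ)y = G(Dφ)y + φ(0)y gives the case k = 1; induction on k collects the
boundary values. -/
theorem resolvent_pow_apply (hG : IsDistributionSemigroup G) (hA : IsGenerator (part A F) G)
    (hR : IsResolventAt A z R) (φ : Test) (y : F) (k : ℕ) :
    (R ^ k) (G ((shiftDeriv z ^ k) φ) y) =
      (G φ y : E) - ∑ j ∈ Finset.range k, ((shiftDeriv z ^ j) φ) 0 • (R ^ (j + 1)) (y : E) := by
  have step (φ : Test) : R (G (shiftDeriv z φ) y) = (G φ y : E) - φ 0 • R y := by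
    have h := (hR _ _).mp (mem_graph_part.mp (hG.apply_mem_graph hA φ y))
    rw [eq_sub_iff_add_eq, ← map_smul, ← map_add]
    convert h using 2
    rw [shiftDeriv_apply]
    simp only [map_add, map_smul, add_apply, smul_apply,
      Submodule.coe_add, Submodule.coe_sub, Submodule.coe_neg, Submodule.coe_smul]
    abel
  induction k with
  | zero => simp
  | succ k ih =>
    rw [pow_succ, mul_apply_eq_comp, pow_succ' (shiftDeriv z),
      mul_apply_eq_comp, step, map_sub, ih, map_smul, Finset.sum_range_succ,
      sub_sub, pow_succ R k, mul_apply_eq_comp]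

/-- `Rⁿ` intertwines the extension with the original distribution. -/
theorem resolvent_pow_extend (hG : IsDistributionSemigroup G) (hA : IsGenerator (part A F) G)
    (hR : IsResolventAt A z R) (hF : ∀ x, (R ^ n) x ∈ F) (φ : Test) (x : E) :
    (R ^ n) (extend G z R n hF φ x) = G φ ⟨(R ^ n) x, hF x⟩ := by
  -- The boundary sums cancel, as powers of R commute.
  rw [extend_apply, map_add, resolvent_pow_apply hG hA hR, map_sum, sub_add_eq_add_sub,
    sub_eq_iff_eq_add]
  congr 1
  refine Finset.sum_congr rfl fun j _ => ?_
  rw [map_smul, ← mul_apply_eq_comp, ← mul_apply_eq_comp,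
    ← pow_add, ← pow_add, add_comm]

theorem dsupport_extend_subset (hG : Distribution.dsupport G ⊆ Set.Ici (0 : ℝ))
    (hF : ∀ x, (R ^ n) x ∈ F) :
    Distribution.dsupport (extend G z R n hF) ⊆ Set.Ici (0 : ℝ) := by
  intro t ht
  by_contra hneg
  obtain ⟨s, hs, hso, hts⟩ := (Distribution.notMem_dsupport_iff t).mp fun h => hneg (hG h)
  refine (Distribution.notMem_dsupport_iff t).mpr
    -- Intersecting with the negative half-line keeps 0 out of the supports, which kills the
    -- boundary values.
    ⟨s ∩ Set.Iio 0, fun φ hφ => ?_, hso.inter isOpen_Iio, hts, Set.mem_Iio.mpr (not_le.mp hneg)⟩ ht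
  have hsub (j : ℕ) := (tsupport_shiftDeriv_pow_subset z j φ).trans hφ
  ext x
  rw [extend_apply, hs _ ((hsub n).trans Set.inter_subset_left),
    Finset.sum_eq_zero fun j _ => by
      rw [image_eq_zero_of_notMem_tsupport fun h => lt_irrefl (0 : ℝ) (Set.mem_Iio.mp (hsub j h).2), zero_smul]]
  simp

/-- The semigroup law and nondegeneracy are tested after applying the injective Rⁿ, which turns them
into statements about `G` on the range of Rⁿ. -/
theorem isDistributionSemigroup_extend (hG : IsDistributionSemigroup G)
    (hA : IsGenerator (part A F) G) (hR : IsResolventAt A z R) (hinj : Function.Injective R)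
    (hF : ∀ x, (R ^ n) x ∈ F) : IsDistributionSemigroup (extend G z R n hF) := by
  have hRn : Function.Injective (R ^ n) := by
    rw [FunLike.coe_pow_eq_iterate]
    exact hinj.iterate n
  have key := resolvent_pow_extend hG hA hR hF
  refine ⟨dsupport_extend_subset hG.support_subset hF, ?_, fun φ ψ => ?_, fun x hx => ?_⟩
  · exact (hG.boundedlyEquicontinuous.conjugate _ _ _).add
      (boundedlyEquicontinuous_sum _ fun j => boundedlyEquicontinuous_smulRight _ _)
  · ext x
    apply hRn
    rw [ContinuousLinearMap.comp_apply, key, key, hG.map_truncConv_apply]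
    congr 2
    exact Subtype.ext (key ψ x).symm
  · have h := hG.nondegenerate ⟨(R ^ n) x, hF x⟩ fun φ hφ =>
      Subtype.ext (by rw [← key, hx φ hφ, map_zero]; rfl)
    exact hRn (by rw [map_zero]; exact congrArg Subtype.val h)

theorem isGenerator_extend (hG : IsDistributionSemigroup G) (hA : IsGenerator (part A F) G)
    (hR : IsResolventAt A z R) (hinj : Function.Injective R) (hF : ∀ x, (R ^ n) x ∈ F) :
    IsGenerator A (extend G z R n hF) := fun x y => by
  have hRn : Function.Injective (R ^ n) := by
    rw [FunLike.coe_pow_eq_iterate]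
    exact hinj.iterate n
  have key := resolvent_pow_extend hG hA hR hF
  have h := hA ⟨(R ^ n) x, hF x⟩ ⟨(R ^ n) y, hF y⟩
  -- (Rⁿx, Rⁿy) lies in the graph of the part exactly when (x, y) lies in that of `A`.
  rw [mem_graph_part, hR.mem_graph_pow_iff hinj] at h
  rw [h]
  refine forall₂_congr fun φ _ => ?_
  rw [← hRn.eq_iff, key, key, Subtype.ext_iff]

theorem generatesDistributionSemigroup_of_part (hz : (resolvents A).Nonempty) (m : ℕ)
    (hA : GeneratesDistributionSemigroup (part A (powDomain A m).topologicalClosure)) :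
    GeneratesDistributionSemigroup A := by
  obtain ⟨z, hz⟩ := hz
  obtain ⟨R, hinj, hR⟩ := exists_isResolventAt hz
  obtain ⟨G, hG, hgen⟩ := hA
  have hF (x : E) : (R ^ m) x ∈ (powDomain A m).topologicalClosure :=
    Submodule.le_topologicalClosure _ (hR.pow_mem_powDomain m x)
  exact ⟨_, isDistributionSemigroup_extend hG hgen hR hinj hF,
    isGenerator_extend hG hgen hR hinj hF⟩

end Extension

end DistSemigroup

theorem mainTheorem11 {E : Type*} [AddCommGroup E] [Module ℂ E] [UniformSpace E]
    [IsUniformAddGroup E] [ContinuousSMul ℂ E] [LocallyConvexSpace ℝ E] [T2Space E]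
    (hE : ∀ u : ℕ → E, CauchySeq u → ∃ x : E, Filter.Tendsto u Filter.atTop (nhds x))
    (A : E →ₗ.[ℂ] E) (hA : DistSemigroup.IsStationaryDense A) :
    (DistSemigroup.GeneratesDistributionSemigroup A →
      DistSemigroup.GeneratesDistributionSemigroup
        (DistSemigroup.part A (DistSemigroup.stationaryClosure A))) ∧
    ((DistSemigroup.resolvents A).Nonempty →
      (DistSemigroup.GeneratesDistributionSemigroup A ↔
        DistSemigroup.GeneratesDistributionSemigroup
          (DistSemigroup.part A (DistSemigroup.stationaryClosure A)))) := by
  have := DistSemigroup.polynormableSpace_complex E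
  exact ⟨fun h => h.part _, fun hz => ⟨fun h => h.part _,
    DistSemigroup.generatesDistributionSemigroup_of_part hz _⟩⟩
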